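/- Let $m,n\ge 0$ be integers, let $\mathfrak g=\mathfrak{gl}(m|2n)$ over $\mathbb C$ with its diagonal Cartan subalgebra $\mathfrak h$, and let $\epsilon_1,\dots,\epsilon_m,\delta_1,\dots,\delta_{2n}$ be the standard basis of $\mathfrak h^*$. A Borel subalgebra $\mathfrak b\supseteq\mathfrak h$ corresponds to an arrangement $\xi_1\xi_2\cdots\xi_{m+2n}$ of the symbols $\epsilon_i,\delta_k$ such that the simple roots of $\mathfrak b$ are the $\xi_j-\xi_{j+1}$; $\mathfrak b$ is called decreasing if, from left to right, the indices of the $\epsilon$'s decrease and the indices of the $\delta$'s decrease. For example, the opposite standard (lower triangular) Borel subalgebra $\mathfrak b^{\mathrm{op}}$ corresponds to $\delta_{2n}\cdots\delta_1\epsilon_m\cdots\epsilon_1$. For decreasing $\mathfrak b$ let $\ell_{i,\mathfrak b}$ be the number of $\delta$'s to the right of $\epsilon_i$. Let $\lambda=(\lambda_1,\lambda_2,\dots)$ be an $m|n$ hook partition, i.e. an integer partition with $\lambda_{m+1}\le n$, with transpose $\lambda'$. Let $V_{2\lambda}$ be the finite-dimensional irreducible $\mathfrak g$-module whose highest weight with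 respect to the standard (upper triangular) Borel subalgebra is $\sum_{i=1}^m 2\lambda_i\epsilon_i+\sum_{j=1}^{2n}\max\{(2\lambda)'_j-m,0\}\,\delta_j$, and let $W_\lambda=(V_{2\lambda})^*$. The $\mathfrak b^{\mathrm{op}}$-highest weight of $W_\lambda$ is $$\underline\lambda_0=-\sum_{i=1}^m 2\lambda_i\epsilon_i-\sum_{j=1}^n\max\{\lambda'_j-m,0\}\,(\delta_{2j-1}+\delta_{2j}).$$ Let $\mathfrak b$ be decreasing. It is obtained from $\mathfrak b^{\mathrm{op}}$ by successive odd reflections in the roots $$\delta_1-\epsilon_m,\dots,\delta_{\ell_{m,\mathfrak b}}-\epsilon_m;\ \ \delta_1-\epsilon_{m-1},\dots,\delta_{\ell_{m-1,\mathfrak b}}-\epsilon_{m-1};\ \ \dots;\ \ \delta_1-\epsilon_1,\dots,\delta_{\ell_{1,\mathfrak b}}-\epsilon_1$$ in this order. Let $\mathcal N_{\mathfrak b}$ be the set of those roots $\alpha$ in this list for which the reflection in $\alpha$ changes the highest weight of $W_\lambda$, from some $\mu$ to $\mu-\alpha$. Then $$\mathcal N_{\mathfrak b}=\{\delta_k-\epsilon_i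 \mid 1\le i\le m,\ 1\le k\le \ell(\lambda,i,\mathfrak b)\},\qquad \ell(\lambda,i,\mathfrak b):=\min\{\ell_{i,\mathfrak b},2\lambda_i\},$$ and, with $r(\lambda,\mathfrak b):=\sum_{\alpha\in\mathcal N_{\mathfrak b}}\alpha$, the (unique) $\mathfrak b$-highest weight of $W_\lambda$ is $\underline\lambda_{\mathfrak b}=\underline\lambda_0-r(\lambda,\mathfrak b)$. -/

import Mathlib

noncomputable section

/-! ### The Lie superalgebra `gl(m|N)` and its modules -/

/-- The index set of the standard basis of `ℂ^{m|N}`: `inl i` is the even index of `ε_i`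
and `inr k` is the odd index of `δ_k` (all indices start at `0`). -/
abbrev GLIdx (m N : ℕ) : Type := Fin m ⊕ Fin N

/-- The parity of a basis vector of `ℂ^{m|N}`. -/
def idxParity {m N : ℕ} : GLIdx m N → ZMod 2
  | Sum.inl _ => 0
  | Sum.inr _ => 1

/-- The underlying space of `gl(m|N)`. -/
abbrev GLMat (m N : ℕ) : Type := Matrix (GLIdx m N) (GLIdx m N) ℂ

/-- The component of parity `p` of an element of `gl(m|N)`. -/
def homPart {m N : ℕ} (p : ZMod 2) : GLMat m N →ₗ[ℂ] GLMat m N where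
  toFun X := Matrix.of fun a b => if idxParity a + idxParity b = p then X a b else 0
  map_add' X Y := by
    ext a b
    simp only [Matrix.of_apply, Matrix.add_apply]
    split_ifs <;> simp
  map_smul' c X := by
    ext a b
    simp [Matrix.of_apply, Matrix.smul_apply]

/-- `X` is homogeneous of parity `p`. -/
def IsHomogeneousMat {m N : ℕ} (p : ZMod 2) (X : GLMat m N) : Prop :=
  ∀ a b, X a b ≠ 0 → idxParity a + idxParity b = p

/-- The sign `(-1)^{pq}`. -/
def koszulSign (p q : ZMod 2) : ℂ := (-1) ^ (p.val * q.val)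

/-- The supercommutator `xy - (-1)^{pq} yx` of elements `x`, `y` of parities `p`, `q`. -/
def superComm {A : Type*} [Ring A] [Algebra ℂ A] (p q : ZMod 2) (x y : A) : A :=
  x * y - koszulSign p q • (y * x)

/-- A (`ℤ/2`-graded) module structure over the Lie superalgebra `gl(m|N)` on a complex
vector space `V`. -/
structure GLModule (m N : ℕ) (V : Type*) [AddCommGroup V] [Module ℂ V] where
  /-- The even part (`p = 0`) and the odd part (`p = 1`) of `V`. -/
  part : ZMod 2 → Submodule ℂ V
  isCompl_part : IsCompl (part 0) (part 1)
  act : GLMat m N →ₗ[ℂ] Module.End ℂ V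
  act_mem : ∀ p q X v, IsHomogeneousMat p X → v ∈ part q → act X v ∈ part (p + q)
  act_superComm : ∀ p q X Y, IsHomogeneousMat p X → IsHomogeneousMat q Y →
    act (superComm p q X Y) = superComm p q (act X) (act Y)

theorem homPart_homogeneous {m N : ℕ} (p : ZMod 2) (X : GLMat m N) :
    IsHomogeneousMat p (homPart p X) := by
  intro a b h
  by_contra hne
  exact h (by simp [homPart, hne])

theorem homPart_eq_self {m N : ℕ} {p : ZMod 2} {X : GLMat m N} (h : IsHomogeneousMat p X) :
    homPart p X = X := by
  ext a b
  by_cases h0 : X a b = 0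
  · simp [homPart, h0]
  · simp [homPart, h a b h0]

theorem homPart_eq_zero {m N : ℕ} {p q : ZMod 2} {X : GLMat m N} (h : IsHomogeneousMat p X)
    (hpq : q ≠ p) : homPart q X = 0 := by
  ext a b
  by_cases h0 : X a b = 0
  · simp [homPart, h0]
  · simp [homPart, h a b h0, hpq.symm]

theorem superComm_homogeneous {m N : ℕ} {p q : ZMod 2} {X Y : GLMat m N}
    (hX : IsHomogeneousMat p X) (hY : IsHomogeneousMat q Y) :
    IsHomogeneousMat (p + q) (superComm p q X Y) := by
  have key : ∀ (p q : ZMod 2) (X Y : GLMat m N), IsHomogeneousMat p X → IsHomogeneousMat q Y →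
      ∀ a b, (X * Y) a b ≠ 0 → idxParity a + idxParity b = p + q := by
    intro p q X Y hX hY a b h
    rw [Matrix.mul_apply] at h
    obtain ⟨c, -, hc⟩ := Finset.exists_ne_zero_of_sum_ne_zero h
    rw [← hX a c (left_ne_zero_of_mul hc), ← hY c b (right_ne_zero_of_mul hc)]
    have h2 : idxParity c + idxParity c = 0 := CharTwo.add_self_eq_zero _
    linear_combination -h2
  intro a b h
  by_contra hne
  apply h
  have h1 : (X * Y) a b = 0 := by
    by_contra h1
    exact hne (key p q X Y hX hY a b h1)
  have h2 : (Y * X) a b = 0 := by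
    by_contra h2
    exact hne ((key q p Y X hY hX a b h2).trans (add_comm _ _))
  simp [superComm, h1, h2]

namespace GLModule

variable {m N : ℕ} {V : Type*} [AddCommGroup V] [Module ℂ V]

/-- The operator `v ↦ (-1)^{p|v|} v` on `V`. -/
def parityTwist (M : GLModule m N V) (p : ZMod 2) : Module.End ℂ V :=
  (M.part 0).projection (M.part 1) M.isCompl_part +
    koszulSign p 1 • (M.part 1).projection (M.part 0) M.isCompl_part.symm

theorem parityTwist_apply (M : GLModule m N V) (p q : ZMod 2) {v : V} (hv : v ∈ M.part q) :
    M.parityTwist p v = koszulSign p q • v := by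
  have h01 : ∀ z : ZMod 2, z = 0 ∨ z = 1 := by decide
  have hq := h01 q
  rcases hq with rfl | rfl
  · have h1 : (M.part 1).projection (M.part 0) M.isCompl_part.symm v = 0 :=
      (Submodule.projection_apply_eq_zero_iff _).2 hv
    simp [parityTwist, h1, Submodule.projection_apply_of_mem_left _ hv, koszulSign]
  · have h1 : (M.part 0).projection (M.part 1) M.isCompl_part v = 0 :=
      (Submodule.projection_apply_eq_zero_iff _).2 hv
    simp [parityTwist, h1, Submodule.projection_apply_of_mem_left _ hv]

theorem end_ext (M : GLModule m N V) {W : Type*} [AddCommGroup W] [Module ℂ W]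
    {f g : V →ₗ[ℂ] W} (h : ∀ q, ∀ v ∈ M.part q, f v = g v) : f = g := by
  ext v
  have hv : v ∈ M.part 0 ⊔ M.part 1 := by
    rw [M.isCompl_part.sup_eq_top]; trivial
  obtain ⟨x, hx, y, hy, rfl⟩ := Submodule.mem_sup.1 hv
  rw [map_add, map_add, h 0 x hx, h 1 y hy]

/-- The linear map `X ↦ (f ↦ X • f)` of the contragredient action on the dual space,
`(X • f)(v) = -(-1)^{|X||f|} f(X v)`. As `f(w) = 0` for homogeneous `f`, `w` of different
parities, the sign `(-1)^{|X||f|}` may be moved to the argument `X v` of `f`. -/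
def dualAct (M : GLModule m N V) : GLMat m N →ₗ[ℂ] Module.End ℂ (Module.Dual ℂ V) :=
  -∑ p : ZMod 2, (Module.Dual.transpose (R := ℂ) (M := V) (M' := V)) ∘ₗ
    (LinearMap.mulLeft ℂ (M.parityTwist p)) ∘ₗ M.act ∘ₗ homPart p

theorem dualAct_apply (M : GLModule m N V) {p : ZMod 2} {X : GLMat m N}
    (hX : IsHomogeneousMat p X) (f : Module.Dual ℂ V) (v : V) :
    M.dualAct X f v = -f (M.parityTwist p (M.act X v)) := by
  have hsum : ∀ F : ZMod 2 → ℂ, (∀ q, q ≠ p → F q = 0) → ∑ q : ZMod 2, F q = F p :=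
    fun F hF => Finset.sum_eq_single p (fun q _ hq => hF q hq) (by simp)
  have := hsum (fun q => f (M.parityTwist q (M.act (homPart q X) v)))
    (fun q hq => by simp [homPart_eq_zero hX hq])
  simp only [homPart_eq_self hX] at this
  rw [← this]
  simp [dualAct, LinearMap.sum_apply, Module.Dual.transpose_apply]

/-- The dual module `V*`. Its part of parity `p` consists of the functionals that vanish on
the part of `V` of the other parity. -/
def dual (M : GLModule m N V) : GLModule m N (Module.Dual ℂ V) where
  part p := (M.part (p + 1)).dualAnnihilator
  isCompl_part := by
    have := Subspace.isCompl_dualAnnihilator M.isCompl_part.symm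
    simpa [show (1 : ZMod 2) + 1 = 0 from rfl] using this
  act := M.dualAct
  act_mem := by
    intro p q X f hX hf
    rw [Submodule.mem_dualAnnihilator] at hf ⊢
    intro v hv
    rw [M.dualAct_apply hX]
    have hm : M.act X v ∈ M.part (q + 1) := by
      have := M.act_mem p _ X v hX hv
      have h01 : ∀ x y : ZMod 2, x + (x + y + 1) = y + 1 := by decide
      have e := h01 p q
      rwa [e] at this
    rw [M.parityTwist_apply p _ hm, map_smul, hf _ hm]
    simp
  act_superComm := by
    intro p q X Y hX hY
    ext f v
    revert v
    refine fun v => LinearMap.congr_fun (M.end_ext (f := M.dualAct (superComm p q X Y) f)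
      (g := superComm p q (M.dualAct X) (M.dualAct Y) f) ?_) v
    intro r v hv
    have hXv := M.act_mem p r X v hX hv
    have hYv := M.act_mem q r Y v hY hv
    have hXY := M.act_mem p _ X _ hX hYv
    have hYX := M.act_mem q _ Y _ hY hXv
    have e : q + (p + r) = p + (q + r) := by ring
    rw [e] at hYX
    rw [M.dualAct_apply (superComm_homogeneous hX hY), M.act_superComm p q X Y hX hY]
    simp only [superComm, LinearMap.sub_apply, LinearMap.smul_apply, Module.End.mul_apply,
      map_sub, map_smul, M.dualAct_apply hX, M.dualAct_apply hY,
      M.parityTwist_apply _ _ hXv, M.parityTwist_apply _ _ hYv,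
      M.parityTwist_apply _ _ hXY, M.parityTwist_apply _ _ hYX, smul_eq_mul]
    generalize f (M.act X (M.act Y v)) = s
    generalize f (M.act Y (M.act X v)) = t
    have h01 : ∀ z : ZMod 2, z = 0 ∨ z = 1 := by decide
    have e2 : (1 : ZMod 2) + 1 = 0 := rfl
    rcases h01 p with rfl | rfl <;> rcases h01 q with rfl | rfl <;> rcases h01 r with rfl | rfl <;>
      simp [koszulSign, e2, ZMod.val_one] <;> ring

/-- `V` is irreducible: it is nonzero and has no graded submodules besides `0` and `V`. -/
def IsIrreducible (M : GLModule m N V) : Prop :=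
  Nontrivial V ∧ ∀ U : Submodule ℂ V, U = (U ⊓ M.part 0) ⊔ (U ⊓ M.part 1) →
    (∀ X, ∀ v ∈ U, M.act X v ∈ U) → U = ⊥ ∨ U = ⊤

end GLModule

/-! ### Borel subalgebras containing the diagonal Cartan subalgebra, and highest weights -/

/-- A `δε`-sequence: an arrangement `ξ_0 ξ_1 ⋯` of the symbols `ε_i`, `δ_k` in a row. -/
abbrev DESeq (m N : ℕ) : Type := Fin (m + N) ≃ GLIdx m N

/-- The Borel subalgebra with simple roots `ξ_j - ξ_{j+1}`: it is spanned by the matrix units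
`E_{ab}` for which `a` is equal to `b` or stands to the left of `b` in the sequence. -/
def borelSubalgebra {m N : ℕ} (ξ : DESeq m N) : Submodule ℂ (GLMat m N) :=
  Submodule.span ℂ {X | ∃ a b, ξ.symm a ≤ ξ.symm b ∧ X = Matrix.single a b 1}

/-- The sequence `ε_1 ⋯ ε_m δ_1 ⋯ δ_N` of the standard (upper triangular) Borel subalgebra. -/
def standardSeq (m N : ℕ) : DESeq m N := finSumFinEquiv.symm

/-- The sequence `δ_N ⋯ δ_1 ε_m ⋯ ε_1` of the opposite (lower triangular) Borel subalgebra. -/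
def oppositeSeq (m N : ℕ) : DESeq m N := Fin.revPerm.trans finSumFinEquiv.symm

/-- Weights, that is, elements of the dual of the Cartan subalgebra, written in the basis
`ε_1, …, ε_m, δ_1, …, δ_N`. -/
abbrev GLWeight (m N : ℕ) : Type := GLIdx m N → ℂ

/-- `μ` is the highest weight of the module with respect to the Borel subalgebra of `ξ`:
there is a nonzero vector on which the Borel subalgebra acts through `μ` (extended by `0` to the
nilradical). -/
def IsHighestWeight {m N : ℕ} {V : Type*} [AddCommGroup V] [Module ℂ V] (M : GLModule m N V)
    (ξ : DESeq m N) (μ : GLWeight m N) : Prop :=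
  ∃ v : V, v ≠ 0 ∧ ∀ X ∈ borelSubalgebra ξ, M.act X v = (∑ a, μ a * X a a) • v

/-- The sequence is decreasing: the indices of the `ε`s decrease from left to right, and so
do the indices of the `δ`s. -/
def IsDecreasing {m N : ℕ} (ξ : DESeq m N) : Prop :=
  (∀ i i' : Fin m, i < i' → ξ.symm (Sum.inl i') < ξ.symm (Sum.inl i)) ∧
  (∀ k k' : Fin N, k < k' → ξ.symm (Sum.inr k') < ξ.symm (Sum.inr k))

/-- `ℓ_i`, the number of `δ`s to the right of `ε_i`. -/
def ell {m N : ℕ} (ξ : DESeq m N) (i : Fin m) : ℕ :=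
  (Finset.univ.filter fun k : Fin N => ξ.symm (Sum.inl i) < ξ.symm (Sum.inr k)).card

/-- The root `δ_k - ε_i`. -/
def deltaSubEps {m N : ℕ} (k : Fin N) (i : Fin m) : GLWeight m N :=
  Pi.single (Sum.inr k) 1 - Pi.single (Sum.inl i) 1

/-- The odd reflection in `± (δ_k - ε_i)` swaps the symbols `δ_k` and `ε_i` in the sequence. -/
def oddReflection {m N : ℕ} (ξ : DESeq m N) (k : Fin N) (i : Fin m) : DESeq m N :=
  ξ.trans (Equiv.swap (Sum.inr k) (Sum.inl i))

/-- The list `δ_1 - ε_m, …, δ_{ℓ_m} - ε_m; …; δ_1 - ε_1, …, δ_{ℓ_1} - ε_1` of roots in which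
one reflects, one after the other, to get from the opposite Borel subalgebra to that of `ξ`.
A root `δ_k - ε_i` is recorded as the pair `(k, i)`. -/
def reflectionList {m N : ℕ} (ξ : DESeq m N) : List (Fin N × Fin m) :=
  (List.finRange m).reverse.flatMap fun i =>
    ((List.finRange N).filter fun k => k.val < ell ξ i).map fun k => (k, i)

/-- The sequence obtained from the opposite one after the first `s` reflections of the list. -/
def reflectionStage {m N : ℕ} (ξ : DESeq m N) (s : ℕ) : DESeq m N :=
  ((reflectionList ξ).take s).foldl (fun η r => oddReflection η r.1 r.2) (oppositeSeq m N)

/-- The set `𝒩` of those roots `α` of the list for which the reflection in `α` changes the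
highest weight of the module, namely from some `μ` to `μ - α`. -/
def changingRoots {m N : ℕ} {V : Type*} [AddCommGroup V] [Module ℂ V] (M : GLModule m N V)
    (ξ : DESeq m N) : Set (GLWeight m N) :=
  {α | ∃ (s : ℕ) (h : s < (reflectionList ξ).length),
    α = deltaSubEps ((reflectionList ξ)[s]).1 ((reflectionList ξ)[s]).2 ∧
    ∃ μ, IsHighestWeight M (reflectionStage ξ s) μ ∧
      IsHighestWeight M (reflectionStage ξ (s + 1)) (μ - α)}

/-! ### Hook partitions -/

/-- `lam = (λ_1, λ_2, …)`, where `λ_{i+1} = lam i`, is an `m|n` hook partition. -/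
def IsHookPartition (m n : ℕ) (lam : ℕ →₀ ℕ) : Prop :=
  Antitone lam ∧ lam m ≤ n

/-- The part `λ'_j = #{i | λ_i ≥ j}` of the transpose partition (for `j ≥ 1`). -/
def transposePart (lam : ℕ →₀ ℕ) (j : ℕ) : ℕ :=
  (lam.support.filter fun i => j ≤ lam i).card

/-- The weight `∑_i κ_i ε_i + ∑_j max(κ'_j - m, 0) δ_j` of an `m|N` hook partition `κ`
(the subtraction is truncated). -/
def hookWeight (m N : ℕ) (kap : ℕ →₀ ℕ) : GLWeight m N
  | Sum.inl i => (kap i : ℂ)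
  | Sum.inr j => ((transposePart kap (j + 1) - m : ℕ) : ℂ)

/-- The module is (isomorphic to) `V_κ`, the irreducible module with highest weight `hookWeight κ`
with respect to the standard Borel subalgebra. -/
def IsHookModule {m N : ℕ} {V : Type*} [AddCommGroup V] [Module ℂ V] (M : GLModule m N V)
    (kap : ℕ →₀ ℕ) : Prop :=
  M.IsIrreducible ∧ IsHighestWeight M (standardSeq m N) (hookWeight m N kap)

/-- The weight `λ_0 = -∑_i 2 λ_i ε_i - ∑_j max(λ'_j - m, 0) (δ_{2j-1} + δ_{2j})` of `gl(m|2n)`. -/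
def lambdaZero (m n : ℕ) (lam : ℕ →₀ ℕ) : GLWeight m (2 * n)
  | Sum.inl i => -(2 * (lam i : ℂ))
  | Sum.inr k => -((transposePart lam (k / 2 + 1) - m : ℕ) : ℂ)

/-- `ℓ(λ, i, 𝔟) = min {ℓ_i, 2 λ_i}`. -/
def ellLam {m n : ℕ} (lam : ℕ →₀ ℕ) (ξ : DESeq m (2 * n)) (i : Fin m) : ℕ :=
  min (ell ξ i) (2 * lam i)

open Classical in
/-- The set of the roots `δ_1 - ε_i, …, δ_{ℓ(λ, i, 𝔟)} - ε_i` for all `i`. -/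
def rootRows {m n : ℕ} (lam : ℕ →₀ ℕ) (ξ : DESeq m (2 * n)) : Finset (GLWeight m (2 * n)) :=
  ((Finset.univ : Finset (Fin (2 * n) × Fin m)).filter fun r => r.1.val < ellLam lam ξ r.2).image
    fun r => deltaSubEps r.1 r.2

/-- `r(λ, 𝔟)`, the sum of these roots. -/
def rLam {m n : ℕ} (lam : ℕ →₀ ℕ) (ξ : DESeq m (2 * n)) : GLWeight m (2 * n) :=
  ∑ α ∈ rootRows lam ξ, α

end

/-! Dualizing turns the standard highest weight vector into one for the opposite Borel subalgebra,
with the negated weight; since the columns of $2\lambda$ come in equal pairs, this weight is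
$\underline\lambda_0$ (`dual_isHighestWeight_neg`, `neg_hookWeight_two_smul`). The dual is again
irreducible, so its highest weight is unique for every Borel subalgebra (`highestWeight_unique`).

An odd reflection in a simple root $\alpha=\delta_k-\epsilon_i$ keeps the highest weight $\mu$ if
$\mu_{\delta_k}+\mu_{\epsilon_i}=0$ and replaces it by $\mu-\alpha$ otherwise
(`oddReflection_isHighestWeight`). The listed roots are simple when their turn comes, because the
two symbols are then adjacent (`IsDecreasing.hasPositions_reflectionStage`), and the last stage is
the given sequence.

It remains to evaluate the sum (`stageWeight_add_eq_zero_iff`; indices start at 0). Suppose that so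
far exactly the roots with $k'<2\lambda_{i'}$ have been subtracted. At the turn of $(k,i)$ the
$\epsilon_i$-coordinate is $-2\lambda_i+\min(k,2\lambda_i)$ and the $\delta_k$-coordinate is at most
$0$. If $k<2\lambda_i$, the sum is negative and the weight changes. If $k\ge 2\lambda_i$, the first
coordinate is $0$; since $\lambda$ decreases, no root with $\delta_k$ has been subtracted yet, and
$\lambda'_{\lfloor k/2\rfloor+1}\le i<m$, so the second is $0$ as well and the weight stays. -/

noncomputable section

/-! ### Matrix units, parities and supercommutation relations -/

theorem single_homogeneous {m N : ℕ} (a b : GLIdx m N) (c : ℂ) :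
    IsHomogeneousMat (idxParity a + idxParity b) (Matrix.single a b c) := by
  intro i j h
  rw [Matrix.single_apply] at h
  obtain ⟨⟨rfl, rfl⟩, -⟩ := ite_ne_right_iff.1 h
  rfl

theorem diagonal_homogeneous {m N : ℕ} (d : GLIdx m N → ℂ) :
    IsHomogeneousMat 0 (Matrix.diagonal d) := by
  intro i j h
  rw [Matrix.diagonal_apply] at h
  obtain ⟨rfl, -⟩ := ite_ne_right_iff.1 h
  exact CharTwo.add_self_eq_zero _

theorem homPart_zero_add_one {m N : ℕ} (X : GLMat m N) : homPart 0 X + homPart 1 X = X := by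
  ext a b
  have h01 : ∀ z : ZMod 2, z = 0 ∨ z = 1 := by decide
  rcases h01 (idxParity a + idxParity b) with h | h <;> simp [homPart, h]

theorem diagonal_eq_sum_single {m N : ℕ} (d : GLIdx m N → ℂ) :
    Matrix.diagonal d = ∑ a, d a • Matrix.single a a (1 : ℂ) := by
  ext i j
  rw [Matrix.sum_apply, Matrix.diagonal_apply]
  split_ifs with h
  · subst h
    rw [Finset.sum_eq_single i] <;> simp +contextual
  · refine (Finset.sum_eq_zero fun a _ => ?_).symm
    rw [Matrix.smul_apply, Matrix.single_apply, if_neg, smul_zero]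
    rintro ⟨rfl, rfl⟩
    exact h rfl

namespace GLModule

variable {m N : ℕ} {V : Type*} [AddCommGroup V] [Module ℂ V]

theorem act_single_act_single (M : GLModule m N V) (a b c d : GLIdx m N) (w : V) :
    M.act (Matrix.single a b 1) (M.act (Matrix.single c d 1) w) =
      koszulSign (idxParity a + idxParity b) (idxParity c + idxParity d) •
        M.act (Matrix.single c d 1) (M.act (Matrix.single a b 1) w) +
      ((if b = c then M.act (Matrix.single a d 1) w else 0) -
        koszulSign (idxParity a + idxParity b) (idxParity c + idxParity d) •
          (if d = a then M.act (Matrix.single c b 1) w else 0)) := by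
  have h := LinearMap.congr_fun (M.act_superComm _ _ _ _
    (single_homogeneous a b 1) (single_homogeneous c d 1)) w
  have h1 : M.act (Matrix.single a b 1 * Matrix.single c d 1) w =
      if b = c then M.act (Matrix.single a d 1) w else 0 := by
    split_ifs with hbc
    · subst hbc; simp
    · simp [Matrix.single_mul_single_of_ne _ _ _ _ hbc]
  have h2 : M.act (Matrix.single c d 1 * Matrix.single a b 1) w =
      if d = a then M.act (Matrix.single c b 1) w else 0 := by
    split_ifs with hbc
    · subst hbc; simp
    · simp [Matrix.single_mul_single_of_ne _ _ _ _ hbc]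
  rw [superComm, map_sub, map_smul, LinearMap.sub_apply, LinearMap.smul_apply, h1, h2] at h
  rw [h, superComm]
  simp

theorem act_diagonal_act_single (M : GLModule m N V) (h : GLIdx m N → ℂ) (a b : GLIdx m N)
    (w : V) : M.act (Matrix.diagonal h) (M.act (Matrix.single a b 1) w) =
      M.act (Matrix.single a b 1) (M.act (Matrix.diagonal h) w) +
        (h a - h b) • M.act (Matrix.single a b 1) w := by
  have e := LinearMap.congr_fun (M.act_superComm _ _ _ _
    (diagonal_homogeneous h) (single_homogeneous a b 1)) w
  have hc : superComm 0 (idxParity a + idxParity b) (Matrix.diagonal h) (Matrix.single a b (1 : ℂ))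
      = (h a - h b) • Matrix.single a b 1 := by
    ext i j
    simp only [superComm, koszulSign, ZMod.val_zero, zero_mul, pow_zero, one_smul,
      Matrix.sub_apply, Matrix.diagonal_mul, Matrix.mul_diagonal, Matrix.smul_apply,
      Matrix.single_apply, smul_eq_mul]
    split_ifs with hh
    · rw [← hh.1, ← hh.2]; ring
    · ring
  rw [hc] at e
  simp only [superComm, koszulSign, ZMod.val_zero, zero_mul, pow_zero, one_smul, map_smul,
    LinearMap.sub_apply, LinearMap.smul_apply, Module.End.mul_apply] at e
  rw [e]
  abel

/-! ### Highest weight vectors -/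

/-- `v` is annihilated by the nilradical of the Borel subalgebra of `ξ` and has weight `μ`. -/
def IsHighestVector (M : GLModule m N V) (ξ : DESeq m N) (μ : GLWeight m N) (v : V) : Prop :=
  (∀ a, M.act (Matrix.single a a 1) v = μ a • v) ∧
    ∀ a b, ξ.symm a < ξ.symm b → M.act (Matrix.single a b 1) v = 0

theorem isHighestWeight_iff (M : GLModule m N V) (ξ : DESeq m N) (μ : GLWeight m N) :
    IsHighestWeight M ξ μ ↔ ∃ v, v ≠ 0 ∧ M.IsHighestVector ξ μ v := by
  refine exists_congr fun v => and_congr_right fun _ => ⟨fun h => ⟨fun a => ?_, fun a b hab => ?_⟩,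
    fun h X hX => ?_⟩
  · rw [h _ (Submodule.subset_span ⟨a, a, le_rfl, rfl⟩)]
    congr 1
    rw [Finset.sum_eq_single a] <;> simp +contextual [eq_comm]
  · rw [h _ (Submodule.subset_span ⟨a, b, hab.le, rfl⟩)]
    have hne : a ≠ b := by rintro rfl; exact lt_irrefl _ hab
    rw [Finset.sum_eq_zero, zero_smul]
    intro c _
    rw [Matrix.single_apply, if_neg, mul_zero]
    rintro ⟨rfl, rfl⟩
    exact hne rfl
  · induction hX using Submodule.span_induction with
    | mem X hX =>
      obtain ⟨a, b, hab, rfl⟩ := hX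
      rcases hab.eq_or_lt with hab | hab
      · obtain rfl := ξ.symm.injective hab
        rw [h.1]
        congr 1
        rw [Finset.sum_eq_single a] <;> simp +contextual [eq_comm]
      · have hne : a ≠ b := by rintro rfl; exact lt_irrefl _ hab
        rw [h.2 _ _ hab, Finset.sum_eq_zero, zero_smul]
        intro c _
        rw [Matrix.single_apply, if_neg, mul_zero]
        rintro ⟨rfl, rfl⟩
        exact hne rfl
    | zero => simp
    | add X Y _ _ hX hY =>
      simp [hX, hY, mul_add, Finset.sum_add_distrib, add_smul]
    | smul c X _ hX =>
      simp only [map_smul, LinearMap.smul_apply, hX, Matrix.smul_apply, smul_smul, smul_eq_mul,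
        Finset.mul_sum]
      congr 1
      exact Finset.sum_congr rfl fun a _ => by ring

theorem IsHighestVector.act_diagonal {M : GLModule m N V} {ξ : DESeq m N} {μ : GLWeight m N}
    {v : V} (hv : M.IsHighestVector ξ μ v) (d : GLIdx m N → ℂ) :
    M.act (Matrix.diagonal d) v = (∑ a, d a * μ a) • v := by
  simp only [diagonal_eq_sum_single, map_sum, map_smul, LinearMap.sum_apply, LinearMap.smul_apply,
    hv.1, Finset.sum_smul, smul_smul]

theorem eq_zero_of_add_eq_zero (M : GLModule m N V) {p q : ZMod 2} (hpq : p ≠ q) {x y : V}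
    (hx : x ∈ M.part p) (hy : y ∈ M.part q) (h : x + y = 0) : x = 0 ∧ y = 0 := by
  have hd : ∀ p q : ZMod 2, p ≠ q → Disjoint (M.part p) (M.part q) := by
    intro p q hpq
    have h01 : ∀ p q : ZMod 2, p ≠ q → (p = 0 ∧ q = 1) ∨ (p = 1 ∧ q = 0) := by decide
    rcases h01 p q hpq with ⟨rfl, rfl⟩ | ⟨rfl, rfl⟩
    exacts [M.isCompl_part.disjoint, M.isCompl_part.symm.disjoint]
  have hx0 : x = 0 := by
    refine Submodule.disjoint_def.1 (hd p q hpq) x hx ?_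
    rw [eq_neg_of_add_eq_zero_left h]
    exact neg_mem hy
  exact ⟨hx0, by simpa [hx0] using h⟩

/-- Matrix units are homogeneous, so both parity components of a highest weight vector satisfy its
equations, and one of them is nonzero. Homogeneity is needed because irreducibility only speaks of
graded submodules. -/
theorem IsHighestVector.exists_homogeneous {M : GLModule m N V} {ξ : DESeq m N}
    {μ : GLWeight m N} {v : V} (hv : M.IsHighestVector ξ μ v) (h0 : v ≠ 0) :
    ∃ q, ∃ w ∈ M.part q, w ≠ 0 ∧ M.IsHighestVector ξ μ w := by
  have hmem : v ∈ M.part 0 ⊔ M.part 1 := by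
    rw [M.isCompl_part.sup_eq_top]; trivial
  obtain ⟨x, hx, y, hy, rfl⟩ := Submodule.mem_sup.1 hmem
  have hne : ∀ p : ZMod 2, p + 0 ≠ p + 1 := by decide
  have hw : ∀ a, M.act (Matrix.single a a 1) x = μ a • x ∧
      M.act (Matrix.single a a 1) y = μ a • y := by
    intro a
    have hp : idxParity a + idxParity a = 0 := CharTwo.add_self_eq_zero _
    have hE := single_homogeneous a a (1 : ℂ)
    rw [hp] at hE
    have h := eq_zero_of_add_eq_zero M (hne 0)
      (sub_mem (M.act_mem _ _ _ _ hE hx) (Submodule.smul_mem _ (μ a) (by simpa using hx)))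
      (sub_mem (M.act_mem _ _ _ _ hE hy) (Submodule.smul_mem _ (μ a) (by simpa using hy))) (by
        have := hv.1 a
        rw [map_add, smul_add] at this
        rw [sub_add_sub_comm, this, sub_self])
    exact ⟨sub_eq_zero.1 h.1, sub_eq_zero.1 h.2⟩
  have hn : ∀ a b, ξ.symm a < ξ.symm b → M.act (Matrix.single a b 1) x = 0 ∧
      M.act (Matrix.single a b 1) y = 0 := by
    intro a b hab
    have hE := single_homogeneous a b (1 : ℂ)
    exact eq_zero_of_add_eq_zero M (hne _) (M.act_mem _ _ _ _ hE hx) (M.act_mem _ _ _ _ hE hy)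
      (by rw [← map_add, hv.2 a b hab])
  by_cases hx0 : x = 0
  · exact ⟨1, y, hy, by simpa [hx0] using h0, fun a => (hw a).2, fun a b hab => (hn a b hab).2⟩
  · exact ⟨0, x, hx, hx0, fun a => (hw a).1, fun a b hab => (hn a b hab).1⟩

/-! ### Uniqueness of the highest weight -/

/-- The vectors obtained from `v` by applying matrix units of the opposite nilradical. -/
inductive Descendant (M : GLModule m N V) (ξ : DESeq m N) (v : V) : V → Prop
  | base : Descendant M ξ v v
  | step (a b : GLIdx m N) (w : V) : ξ.symm b < ξ.symm a → Descendant M ξ v w →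
      Descendant M ξ v (M.act (Matrix.single a b 1) w)

/-- A weak substitute for the PBW theorem. In the induction on descendants, moving a matrix unit
past the last lowering operator leaves terms in which single matrix units act on the shorter
descendant, so the hypothesis must cover all matrix units at once. -/
theorem IsHighestVector.act_mem_span {M : GLModule m N V} {ξ : DESeq m N}
    {μ : GLWeight m N} {v : V} (hv : M.IsHighestVector ξ μ v) (X : GLMat m N) {w : V}
    (hw : w ∈ Submodule.span ℂ {w | Descendant M ξ v w}) :
    M.act X w ∈ Submodule.span ℂ {w | Descendant M ξ v w} := by
  have hlow : ∀ a b, ξ.symm b < ξ.symm a → ∀ w ∈ Submodule.span ℂ {w | Descendant M ξ v w},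
      M.act (Matrix.single a b 1) w ∈ Submodule.span ℂ {w | Descendant M ξ v w} := by
    intro a b hab w hw
    induction hw using Submodule.span_induction with
    | mem w hw => exact Submodule.subset_span (Descendant.step a b w hab hw)
    | zero => simp
    | add x y _ _ hx hy => rw [map_add]; exact add_mem hx hy
    | smul c x _ hx => rw [map_smul]; exact Submodule.smul_mem _ _ hx
  have hunit : ∀ w, Descendant M ξ v w → ∀ a b, M.act (Matrix.single a b 1) w ∈
      Submodule.span ℂ {w | Descendant M ξ v w} := by
    intro w hw
    induction hw with
    | base =>
      intro a b
      rcases lt_trichotomy (ξ.symm a) (ξ.symm b) with h | h | h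
      · rw [hv.2 a b h]; exact zero_mem _
      · obtain rfl := ξ.symm.injective h
        rw [hv.1]; exact Submodule.smul_mem _ _ (Submodule.subset_span Descendant.base)
      · exact Submodule.subset_span (Descendant.step a b v h Descendant.base)
    | step c d w hcd _ ih =>
      intro a b
      rw [act_single_act_single]
      refine add_mem (Submodule.smul_mem _ _ (hlow c d hcd _ (ih a b)))
        (sub_mem ?_ (Submodule.smul_mem _ _ ?_))
      · split_ifs; exacts [ih _ _, zero_mem _]
      · split_ifs; exacts [ih _ _, zero_mem _]
  have hall : ∀ a b, M.act (Matrix.single a b 1) w ∈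
      Submodule.span ℂ {w | Descendant M ξ v w} := by
    intro a b
    induction hw using Submodule.span_induction with
    | mem w hw => exact hunit w hw a b
    | zero => simp
    | add x y _ _ hx hy => rw [map_add]; exact add_mem hx hy
    | smul c x _ hx => rw [map_smul]; exact Submodule.smul_mem _ _ hx
  rw [Matrix.matrix_eq_sum_single X]
  simp only [map_sum, LinearMap.sum_apply]
  refine sum_mem fun a _ => sum_mem fun b _ => ?_
  have : Matrix.single a b (X a b) = X a b • Matrix.single a b (1 : ℂ) := by simp
  rw [this, map_smul]
  exact Submodule.smul_mem _ _ (hall a b)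

theorem span_eq_sup_of_homogeneous (M : GLModule m N V) {S : Set V}
    (hS : ∀ w ∈ S, ∃ q, w ∈ M.part q) :
    Submodule.span ℂ S = (Submodule.span ℂ S ⊓ M.part 0) ⊔ (Submodule.span ℂ S ⊓ M.part 1) := by
  refine le_antisymm (Submodule.span_le.2 fun w hw => ?_) (sup_le inf_le_left inf_le_left)
  obtain ⟨q, hq⟩ := hS w hw
  have h01 : ∀ z : ZMod 2, z = 0 ∨ z = 1 := by decide
  rcases h01 q with rfl | rfl
  · exact Submodule.mem_sup_left ⟨Submodule.subset_span hw, hq⟩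
  · exact Submodule.mem_sup_right ⟨Submodule.subset_span hw, hq⟩

theorem Descendant.homogeneous {M : GLModule m N V} {ξ : DESeq m N} {v w : V}
    (hw : Descendant M ξ v w) {q : ZMod 2} (hv : v ∈ M.part q) : ∃ q, w ∈ M.part q := by
  induction hw with
  | base => exact ⟨q, hv⟩
  | step a b w _ _ ih =>
    obtain ⟨p, hp⟩ := ih
    exact ⟨_, M.act_mem _ _ _ _ (single_homogeneous a b 1) hp⟩

/-- A diagonal matrix with integral entries that decrease along the sequence `ξ`. -/
def heightMat (ξ : DESeq m N) : GLMat m N := Matrix.diagonal fun a => -((ξ.symm a : ℕ) : ℂ)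

/-- The value of the weight `μ` on `heightMat ξ`. -/
def heightVal (ξ : DESeq m N) (μ : GLWeight m N) : ℂ := ∑ a, -((ξ.symm a : ℕ) : ℂ) * μ a

/-- The sum of the eigenspaces of `heightMat ξ` strictly below height `c`. -/
def lowerPart (M : GLModule m N V) (ξ : DESeq m N) (c : ℂ) : Submodule ℂ V :=
  ⨆ k : ℕ, (M.act (heightMat ξ)).eigenspace (c - (k + 1))

theorem act_single_mem_eigenspace (M : GLModule m N V) (ξ : DESeq m N) {a b : GLIdx m N} {c : ℂ}
    {w : V} (hw : w ∈ (M.act (heightMat ξ)).eigenspace c) :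
    M.act (Matrix.single a b 1) w ∈
      (M.act (heightMat ξ)).eigenspace (c - ((ξ.symm a : ℕ) - (ξ.symm b : ℕ))) := by
  rw [Module.End.mem_eigenspace_iff] at hw ⊢
  rw [heightMat, act_diagonal_act_single, ← heightMat, hw, map_smul, ← add_smul]
  congr 1
  ring

theorem act_single_mem_lowerPart_of_eigenspace (M : GLModule m N V) (ξ : DESeq m N)
    {a b : GLIdx m N} (hab : ξ.symm b < ξ.symm a) {c : ℂ} {k : ℕ} {w : V}
    (hw : w ∈ (M.act (heightMat ξ)).eigenspace (c - k)) :
    M.act (Matrix.single a b 1) w ∈ M.lowerPart ξ c := by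
  obtain ⟨j, hj⟩ := Nat.exists_eq_add_of_lt (Fin.lt_def.1 hab)
  have := M.act_single_mem_eigenspace ξ (a := a) (b := b) hw
  refine Submodule.mem_iSup_of_mem (k + j) ?_
  convert this using 2
  rw [hj]
  push_cast
  ring

theorem IsHighestVector.mem_eigenspace {M : GLModule m N V} {ξ : DESeq m N}
    {μ : GLWeight m N} {v : V} (hv : M.IsHighestVector ξ μ v) :
    v ∈ (M.act (heightMat ξ)).eigenspace (heightVal ξ μ) := by
  rw [Module.End.mem_eigenspace_iff, heightMat, hv.act_diagonal]
  rfl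

theorem disjoint_eigenspace_lowerPart (M : GLModule m N V) (ξ : DESeq m N) (c : ℂ) :
    Disjoint ((M.act (heightMat ξ)).eigenspace c) (M.lowerPart ξ c) := by
  refine ((M.act (heightMat ξ)).eigenspaces_iSupIndep c).mono_right (iSup_le fun k => ?_)
  refine le_iSup₂_of_le (c - (k + 1)) ?_ le_rfl
  intro h
  have : (k : ℂ) + 1 = 0 := by linear_combination -h
  exact Nat.cast_add_one_ne_zero k this

/-- By irreducibility the descendants of `v` span `V`, and each lowering operator drops the height
by a positive integer; so only multiples of `v` survive at the top height. -/
theorem IsHighestVector.span_sup_lowerPart {M : GLModule m N V} (hM : M.IsIrreducible)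
    {ξ : DESeq m N} {μ : GLWeight m N} {v : V} (hv : M.IsHighestVector ξ μ v) (h0 : v ≠ 0)
    {q : ZMod 2} (hq : v ∈ M.part q) :
    Submodule.span ℂ {v} ⊔ M.lowerPart ξ (heightVal ξ μ) = ⊤ := by
  have htop : Submodule.span ℂ {w | Descendant M ξ v w} = ⊤ := by
    refine (hM.2 _ (M.span_eq_sup_of_homogeneous fun w hw => Descendant.homogeneous hw hq)
      fun X w hw => hv.act_mem_span X hw).resolve_left fun h => h0 ?_
    have : v ∈ Submodule.span ℂ {w | Descendant M ξ v w} := Submodule.subset_span Descendant.base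
    exact (Submodule.mem_bot ℂ).1 (h ▸ this)
  have key : ∀ w, Descendant M ξ v w → w ∈ Submodule.span ℂ {v} ⊔ M.lowerPart ξ (heightVal ξ μ) ∧
      ∃ k : ℕ, w ∈ (M.act (heightMat ξ)).eigenspace (heightVal ξ μ - k) := by
    intro w hw
    induction hw with
    | base =>
      exact ⟨Submodule.mem_sup_left (Submodule.mem_span_singleton_self v), 0,
        by simpa using hv.mem_eigenspace⟩
    | step a b w hab _ ih =>
      obtain ⟨-, k, hk⟩ := ih
      refine ⟨Submodule.mem_sup_right (M.act_single_mem_lowerPart_of_eigenspace ξ hab hk), ?_⟩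
      obtain ⟨j, hj⟩ := Nat.exists_eq_add_of_lt (Fin.lt_def.1 hab)
      refine ⟨k + (j + 1), ?_⟩
      convert M.act_single_mem_eigenspace ξ (a := a) (b := b) hk using 2
      rw [hj]
      push_cast
      ring
  rw [eq_top_iff, ← htop, Submodule.span_le]
  exact fun w hw => (key w hw).1

/-- `V` is the sum of the eigenspaces at heights `heightVal ξ μ - k`, and eigenspaces are
independent, so no other height admits an eigenvector. -/
theorem IsHighestVector.exists_heightVal_eq {M : GLModule m N V} (hM : M.IsIrreducible)
    {ξ : DESeq m N} {μ μ' : GLWeight m N} {v v' : V} (hv : M.IsHighestVector ξ μ v) (h0 : v ≠ 0)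
    (hv' : M.IsHighestVector ξ μ' v') (h0' : v' ≠ 0) :
    ∃ k : ℕ, heightVal ξ μ' = heightVal ξ μ - k := by
  obtain ⟨q, w, hq, hw0, hw⟩ := hv.exists_homogeneous h0
  by_contra! hne
  refine h0' (Submodule.disjoint_def.1 ((M.act (heightMat ξ)).eigenspaces_iSupIndep
    (heightVal ξ μ')) v' hv'.mem_eigenspace ?_)
  have hle : (⊤ : Submodule ℂ V) ≤ ⨆ c, ⨆ (_ : c ≠ heightVal ξ μ'),
      (M.act (heightMat ξ)).eigenspace c := by
    rw [← hw.span_sup_lowerPart hM hw0 hq]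
    refine sup_le (Submodule.span_le.2 (Set.singleton_subset_iff.2 ?_)) (iSup_le fun k => ?_)
    · exact Submodule.mem_iSup_of_mem (heightVal ξ μ) (Submodule.mem_iSup_of_mem
        (by simpa using (hne 0).symm) hw.mem_eigenspace)
    · exact le_iSup₂_of_le _ (by simpa using (hne (k + 1)).symm) le_rfl
  exact hle trivial

/-- Each height lies a nonnegative integer below the other, so they agree. Then `v'` lies in the top
eigenspace, which is a line spanned by a vector of weight `μ`. -/
theorem IsHighestVector.weight_unique {M : GLModule m N V} (hM : M.IsIrreducible)
    {ξ : DESeq m N} {μ μ' : GLWeight m N} {v v' : V} (hv : M.IsHighestVector ξ μ v) (h0 : v ≠ 0)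
    (hv' : M.IsHighestVector ξ μ' v') (h0' : v' ≠ 0) : μ = μ' := by
  obtain ⟨k, hk⟩ := hv.exists_heightVal_eq hM h0 hv' h0'
  obtain ⟨k', hk'⟩ := hv'.exists_heightVal_eq hM h0' hv h0
  have hk0 : k = 0 := by
    have : ((k + k' : ℕ) : ℂ) = 0 := by push_cast; linear_combination hk + hk'
    have := Nat.cast_eq_zero.1 this
    omega
  obtain ⟨q, w, hq, hw0, hw⟩ := hv.exists_homogeneous h0
  have hmem : v' ∈ Submodule.span ℂ {w} ⊔ M.lowerPart ξ (heightVal ξ μ) := by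
    rw [hw.span_sup_lowerPart hM hw0 hq]; trivial
  obtain ⟨x, hx, r, hr, hxr⟩ := Submodule.mem_sup.1 hmem
  obtain ⟨c, rfl⟩ := Submodule.mem_span_singleton.1 hx
  have hr0 : r = 0 := by
    refine Submodule.disjoint_def.1 (M.disjoint_eigenspace_lowerPart ξ (heightVal ξ μ)) r ?_ hr
    have h1 := hv'.mem_eigenspace
    rw [hk, hk0, Nat.cast_zero, sub_zero] at h1
    rw [eq_sub_of_add_eq' hxr]
    exact sub_mem h1 (Submodule.smul_mem _ _ hw.mem_eigenspace)
  rw [hr0, add_zero] at hxr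
  funext a
  have h1 := hv'.1 a
  rw [← hxr, map_smul, hw.1, smul_comm, hxr] at h1
  exact smul_left_injective ℂ h0' h1

theorem highestWeight_unique {M : GLModule m N V} (hM : M.IsIrreducible) {ξ : DESeq m N}
    {μ μ' : GLWeight m N} (h : IsHighestWeight M ξ μ) (h' : IsHighestWeight M ξ μ') : μ = μ' := by
  obtain ⟨v, h0, hv⟩ := (M.isHighestWeight_iff ξ μ).1 h
  obtain ⟨v', h0', hv'⟩ := (M.isHighestWeight_iff ξ μ').1 h'
  exact hv.weight_unique hM h0 hv' h0'

end GLModule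
end

/-! ### The dual module -/

noncomputable section
namespace GLModule

variable {m N : ℕ} {V : Type*} [AddCommGroup V] [Module ℂ V]

theorem dual_act_apply (M : GLModule m N V) {p : ZMod 2} {X : GLMat m N}
    (hX : IsHomogeneousMat p X) (f : Module.Dual ℂ V) (v : V) :
    M.dual.act X f v = -f (M.parityTwist p (M.act X v)) :=
  M.dualAct_apply hX f v

theorem parityTwist_zero (M : GLModule m N V) : M.parityTwist 0 = LinearMap.id := by
  refine M.end_ext fun q v hv => ?_
  rw [M.parityTwist_apply 0 q hv]
  simp [koszulSign]

/-- A homogeneous functional sees only vectors of its own parity, on which the twist is a scalar. -/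
theorem dual_part_apply_parityTwist (M : GLModule m N V) {f : Module.Dual ℂ V} {q : ZMod 2}
    (hf : f ∈ M.dual.part q) (p : ZMod 2) (v : V) :
    f (M.parityTwist p v) = koszulSign p q * f v := by
  have hf' : ∀ w ∈ M.part (q + 1), f w = 0 := (Submodule.mem_dualAnnihilator f).1 hf
  refine LinearMap.congr_fun (M.end_ext (f := f ∘ₗ M.parityTwist p) (g := koszulSign p q • f)
    fun r w hw => ?_) v
  have h01 : ∀ q r : ZMod 2, r = q ∨ r = q + 1 := by decide
  rw [LinearMap.comp_apply, M.parityTwist_apply p r hw]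
  rcases h01 q r with rfl | rfl
  · simp
  · simp [hf' w hw]

/-- The common kernel of a graded submodule `U` of the dual is a graded submodule of `V`, hence `⊥`
or `⊤`; in finite dimension `U` is recovered as its annihilator. -/
theorem dual_isIrreducible [FiniteDimensional ℂ V] {M : GLModule m N V} (hM : M.IsIrreducible) :
    M.dual.IsIrreducible := by
  have := hM.1
  refine ⟨inferInstance, fun U hU hact => ?_⟩
  have hC : ∀ v, v ∈ U.dualCoannihilator ↔ ∀ q, ∀ f ∈ U, f ∈ M.dual.part q → f v = 0 := by
    intro v
    rw [Submodule.mem_dualCoannihilator]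
    refine ⟨fun h q f hf _ => h f hf, fun h f hf => ?_⟩
    rw [hU] at hf
    obtain ⟨x, hx, y, hy, rfl⟩ := Submodule.mem_sup.1 hf
    rw [LinearMap.add_apply, h 0 x hx.1 hx.2, h 1 y hy.1 hy.2, add_zero]
  have hsign : ∀ p q, koszulSign p q ≠ 0 := fun p q => pow_ne_zero _ (by norm_num)
  have hhom : ∀ p X, IsHomogeneousMat p X → ∀ v ∈ U.dualCoannihilator,
      M.act X v ∈ U.dualCoannihilator := by
    intro p X hX v hv
    rw [hC]
    intro q f hf hfq
    have h := (Submodule.mem_dualCoannihilator v).1 hv _ (hact X f hf)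
    rw [M.dual_act_apply hX, M.dual_part_apply_parityTwist hfq, neg_eq_zero] at h
    exact (mul_eq_zero.1 h).resolve_left (hsign p q)
  have hgr : U.dualCoannihilator =
      (U.dualCoannihilator ⊓ M.part 0) ⊔ (U.dualCoannihilator ⊓ M.part 1) := by
    refine le_antisymm (fun v hv => ?_) (sup_le inf_le_left inf_le_left)
    have hmem : v ∈ M.part 0 ⊔ M.part 1 := by
      rw [M.isCompl_part.sup_eq_top]; trivial
    obtain ⟨x, hx, y, hy, rfl⟩ := Submodule.mem_sup.1 hmem
    rw [hC] at hv
    have h01 : ∀ z : ZMod 2, z = 0 ∨ z = 1 := by decide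
    have hkill : ∀ q f, f ∈ M.dual.part q → ∀ w ∈ M.part (q + 1), f w = 0 :=
      fun q f hf => (Submodule.mem_dualAnnihilator f).1 hf
    -- A homogeneous functional kills the component of the other parity outright, and then its value
    -- on the remaining component is its value on the sum.
    refine Submodule.add_mem_sup ⟨(hC x).2 fun q f hf hfq => ?_, hx⟩
      ⟨(hC y).2 fun q f hf hfq => ?_, hy⟩
    · rcases h01 q with rfl | rfl
      · have := hv 0 f hf hfq
        rwa [map_add, hkill 0 f hfq y hy, add_zero] at this
      · exact hkill 1 f hfq x hx
    · rcases h01 q with rfl | rfl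
      · exact hkill 0 f hfq y hy
      · have := hv 1 f hf hfq
        rwa [map_add, hkill 1 f hfq x hx, zero_add] at this
  have hfin : U.dualCoannihilator.dualAnnihilator = U :=
    Subspace.dualCoannihilator_dualAnnihilator_eq
  rcases hM.2 _ hgr (fun X v hv => by
    rw [← homPart_zero_add_one X, map_add]
    exact add_mem (hhom 0 _ (homPart_homogeneous 0 X) v hv)
      (hhom 1 _ (homPart_homogeneous 1 X) v hv)) with h | h
  · right; rw [← hfin, h, Submodule.dualAnnihilator_bot]
  · left; rw [← hfin, h, Submodule.dualAnnihilator_top]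

theorem act_single_mem_lowerPart (M : GLModule m N V) (ξ : DESeq m N) {a b : GLIdx m N}
    (hab : ξ.symm b ≤ ξ.symm a) {c : ℂ} {w : V} (hw : w ∈ M.lowerPart ξ c) :
    M.act (Matrix.single a b 1) w ∈ M.lowerPart ξ c := by
  obtain ⟨j, hj⟩ := Nat.exists_eq_add_of_le (Fin.le_def.1 hab)
  refine Submodule.iSup_induction _ (motive := fun w => M.act (Matrix.single a b 1) w ∈
    M.lowerPart ξ c) hw (fun k w hw => ?_) (by simp) fun x y hx hy => ?_
  · refine Submodule.mem_iSup_of_mem (k + j) ?_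
    convert M.act_single_mem_eigenspace ξ (a := a) (b := b) hw using 2
    rw [hj]
    push_cast
    ring
  · rw [map_add]; exact add_mem hx hy

theorem parityTwist_mem_lowerPart (M : GLModule m N V) (ξ : DESeq m N) (p : ZMod 2) {c : ℂ}
    {w : V} (hw : w ∈ M.lowerPart ξ c) : M.parityTwist p w ∈ M.lowerPart ξ c := by
  have hcomm : M.parityTwist p ∘ₗ M.act (heightMat ξ) = M.act (heightMat ξ) ∘ₗ M.parityTwist p := by
    refine M.end_ext fun q v hv => ?_
    have h := M.act_mem 0 q (heightMat ξ) v (diagonal_homogeneous _) hv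
    rw [zero_add] at h
    rw [LinearMap.comp_apply, LinearMap.comp_apply, M.parityTwist_apply p q h,
      M.parityTwist_apply p q hv, map_smul]
  refine Submodule.iSup_induction _ (motive := fun w => M.parityTwist p w ∈
    M.lowerPart ξ c) hw (fun k w hw => ?_) (by simp) fun x y hx hy => ?_
  · refine Submodule.mem_iSup_of_mem k ?_
    rw [Module.End.mem_eigenspace_iff] at hw ⊢
    have h := LinearMap.congr_fun hcomm w
    rw [LinearMap.comp_apply, LinearMap.comp_apply] at h
    rw [← h, hw, map_smul]
  · rw [map_add]; exact add_mem hx hy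

/-- The new highest weight vector is a functional that vanishes on the lower part but not at `v`.
Matrix units raising for `η` are lowering for `ξ`, so they map `V` into the lower part and kill the
functional; the diagonal ones act on it by the negated weight. -/
theorem dual_isHighestWeight_neg {M : GLModule m N V} (hM : M.IsIrreducible) {ξ η : DESeq m N}
    (hη : ∀ a b, η.symm a < η.symm b → ξ.symm b < ξ.symm a) {μ : GLWeight m N}
    (h : IsHighestWeight M ξ μ) : IsHighestWeight M.dual η (-μ) := by
  obtain ⟨v', h0', hv'⟩ := (M.isHighestWeight_iff ξ μ).1 h
  obtain ⟨q, v, hq, h0, hv⟩ := hv'.exists_homogeneous h0'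
  have htop := hv.span_sup_lowerPart hM h0 hq
  have hnot : v ∉ M.lowerPart ξ (heightVal ξ μ) := fun hmem => h0
    (Submodule.disjoint_def.1 (M.disjoint_eigenspace_lowerPart ξ _) v hv.mem_eigenspace hmem)
  obtain ⟨f, hfv, hf⟩ := Submodule.exists_le_ker_of_notMem hnot
  have hf : ∀ w ∈ M.lowerPart ξ (heightVal ξ μ), f w = 0 := fun w hw => hf hw
  have hdec : ∀ u, ∃ c : ℂ, ∃ r ∈ M.lowerPart ξ (heightVal ξ μ), u = c • v + r := by
    intro u
    have hu : u ∈ Submodule.span ℂ {v} ⊔ M.lowerPart ξ (heightVal ξ μ) := by rw [htop]; trivial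
    obtain ⟨x, hx, r, hr, rfl⟩ := Submodule.mem_sup.1 hu
    obtain ⟨c, rfl⟩ := Submodule.mem_span_singleton.1 hx
    exact ⟨c, r, hr, rfl⟩
  refine (M.dual.isHighestWeight_iff η (-μ)).2 ⟨f, ?_, fun a => ?_, fun a b hab => ?_⟩
  · rintro rfl
    exact hfv rfl
  · ext u
    obtain ⟨c, r, hr, rfl⟩ := hdec u
    have hp : idxParity a + idxParity a = 0 := CharTwo.add_self_eq_zero _
    rw [M.dual_act_apply (single_homogeneous a a 1), hp, parityTwist_zero]
    simp only [LinearMap.id_apply, map_add, map_smul, hv.1, LinearMap.smul_apply,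
      hf _ (M.act_single_mem_lowerPart ξ le_rfl hr), hf r hr, smul_eq_mul, Pi.neg_apply]
    ring
  · ext u
    have hlt := hη a b hab
    obtain ⟨c, r, hr, rfl⟩ := hdec u
    have hmem : M.act (Matrix.single a b 1) (c • v + r) ∈ M.lowerPart ξ (heightVal ξ μ) := by
      rw [map_add, map_smul]
      refine add_mem (Submodule.smul_mem _ _ ?_) (M.act_single_mem_lowerPart ξ hlt.le hr)
      exact M.act_single_mem_lowerPart_of_eigenspace ξ hlt (k := 0)
        (by simpa using hv.mem_eigenspace)
    rw [M.dual_act_apply (single_homogeneous a b 1), hf _ (M.parityTwist_mem_lowerPart ξ _ hmem)]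
    simp

/-! ### Odd reflections -/

theorem oddReflection_symm_lt {ξ : DESeq m N} {k : Fin N} {i : Fin m}
    (hadj : (ξ.symm (Sum.inr k)).val + 1 = (ξ.symm (Sum.inl i)).val) {a b : GLIdx m N}
    (hab : (oddReflection ξ k i).symm a < (oddReflection ξ k i).symm b) :
    (a = Sum.inl i ∧ b = Sum.inr k) ∨
      (ξ.symm a < ξ.symm b ∧ ¬(a = Sum.inr k ∧ b = Sum.inl i)) := by
  have hs : ∀ c, (oddReflection ξ k i).symm c = ξ.symm (Equiv.swap (Sum.inr k) (Sum.inl i) c) := by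
    intro c; simp [oddReflection]
  rw [hs, hs, Fin.lt_def] at hab
  have hne : ∀ {c c' : GLIdx m N}, c ≠ c' → (ξ.symm c).val ≠ (ξ.symm c').val := fun h h' =>
    h (ξ.symm.injective (Fin.ext h'))
  rw [Fin.lt_def]
  rw [Equiv.swap_apply_def, Equiv.swap_apply_def] at hab
  by_cases ha : a = Sum.inr k
  · subst ha
    by_cases hb : b = Sum.inl i
    · subst hb; simp at hab; omega
    · refine Or.inr ⟨?_, fun h => hb h.2⟩
      by_cases hb' : b = Sum.inr k
      · subst hb'; simp at hab
      · simp [hb, hb'] at hab; omega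
  · by_cases ha' : a = Sum.inl i
    · subst ha'
      by_cases hb' : b = Sum.inr k
      · exact Or.inl ⟨rfl, hb'⟩
      · refine Or.inr ⟨?_, by simp⟩
        by_cases hb : b = Sum.inl i
        · subst hb; simp at hab
        · simp [hb, hb'] at hab
          have := hne hb
          omega
    · refine Or.inr ⟨?_, fun h => ha h.1⟩
      have h1 := hne ha
      by_cases hb' : b = Sum.inr k
      · subst hb'; simp [ha, ha'] at hab; omega
      · by_cases hb : b = Sum.inl i
        · subst hb; simp [ha, ha'] at hab; omega
        · simpa [ha, ha', hb, hb'] using hab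

/-- Let `E`, `F` be the matrix units of the root and its negative. Then `E F v = (μ d + μ e) v`,
because `E v = 0`. If the scalar is nonzero, so is `F v`, and `F ^ 2 = 0` makes it highest for the
new Borel subalgebra. If the scalar is zero, a nonzero `F v` would be a second highest weight vector
for `ξ`, of another weight; so `F v = 0`, and `v` itself remains highest. -/
theorem oddReflection_isHighestWeight {M : GLModule m N V} (hM : M.IsIrreducible) {ξ : DESeq m N}
    {k : Fin N} {i : Fin m}
    (hadj : (ξ.symm (Sum.inr k)).val + 1 = (ξ.symm (Sum.inl i)).val) {μ : GLWeight m N}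
    (h : IsHighestWeight M ξ μ) :
    IsHighestWeight M (oddReflection ξ k i)
      (if μ (Sum.inr k) + μ (Sum.inl i) = 0 then μ else μ - deltaSubEps k i) := by
  obtain ⟨v, h0, hv⟩ := (M.isHighestWeight_iff ξ μ).1 h
  set d : GLIdx m N := Sum.inr k with hd
  set e : GLIdx m N := Sum.inl i with he
  have hde : d ≠ e := by simp [hd, he]
  have hpe : idxParity e + idxParity d = 1 := rfl
  have hpd : idxParity d + idxParity e = 1 := rfl
  set F := M.act (Matrix.single e d 1) with hF
  have hαd : deltaSubEps k i d = 1 := by simp [deltaSubEps, hd]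
  have hαe : deltaSubEps k i e = -1 := by simp [deltaSubEps, he]
  have hα : ∀ a, a ≠ d → a ≠ e → deltaSubEps k i a = 0 := fun a ha ha' => by
    simp [deltaSubEps, ha, ha', ← hd, ← he]
  have hFw : ∀ a, M.act (Matrix.single a a 1) (F v) = (μ - deltaSubEps k i) a • F v := by
    intro a
    have hp : idxParity a + idxParity a = 0 := CharTwo.add_self_eq_zero _
    have hs : koszulSign 0 1 = 1 := by simp [koszulSign]
    rw [hF, act_single_act_single, hp, hpe, hs, hv.1, map_smul, one_smul, one_smul, ← hF]
    by_cases ha : a = e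
    · subst ha
      rw [if_pos rfl, if_neg hde, Pi.sub_apply, hαe, ← hF]
      module
    · by_cases ha' : a = d
      · subst ha'
        rw [if_neg ha, if_pos rfl, Pi.sub_apply, hαd, ← hF]
        module
      · rw [if_neg ha, if_neg (Ne.symm ha')]
        rw [Pi.sub_apply, hα a ha' ha]
        module
  have hFn : ∀ a b, ξ.symm a < ξ.symm b → ¬(a = d ∧ b = e) →
      M.act (Matrix.single a b 1) (F v) = 0 := by
    intro a b hab hne
    -- By adjacency, a symbol other than `d` to the left of `e` is already to the left of `d`;
    -- symmetrically for `h2`.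
    have h1 : b = e → M.act (Matrix.single a d 1) v = 0 := by
      rintro rfl
      refine hv.2 _ _ ?_
      have hd' : (ξ.symm a).val ≠ (ξ.symm d).val := fun h' =>
        hne ⟨ξ.symm.injective (Fin.ext h'), rfl⟩
      rw [Fin.lt_def] at hab ⊢
      omega
    have h2 : d = a → M.act (Matrix.single e b 1) v = 0 := by
      rintro rfl
      refine hv.2 _ _ ?_
      have hd' : (ξ.symm b).val ≠ (ξ.symm e).val := fun h' =>
        hne ⟨rfl, ξ.symm.injective (Fin.ext h')⟩
      rw [Fin.lt_def] at hab ⊢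
      omega
    have h1' : (if b = e then M.act (Matrix.single a d 1) v else 0) = 0 := by
      split_ifs with hb; exacts [h1 hb, rfl]
    have h2' : (if d = a then M.act (Matrix.single e b 1) v else 0) = 0 := by
      split_ifs with ha; exacts [h2 ha, rfl]
    rw [hF, act_single_act_single, hv.2 a b hab, map_zero, h1', h2', smul_zero,
      sub_zero, add_zero]
  have hEF : M.act (Matrix.single d e 1) (F v) = (μ d + μ e) • v := by
    have hlt : ξ.symm d < ξ.symm e := by rw [Fin.lt_def]; omega
    have hs : koszulSign 1 1 = -1 := by simp [koszulSign, ZMod.val_one]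
    rw [hF, act_single_act_single, hv.2 d e hlt, hpe, hpd, hs, if_pos rfl, if_pos rfl, hv.1, hv.1,
      map_zero]
    module
  by_cases hz : μ d + μ e = 0
  · rw [if_pos hz]
    have hFv : F v = 0 := by
      by_contra hne
      have hhv : M.IsHighestVector ξ (μ - deltaSubEps k i) (F v) := by
        refine ⟨hFw, fun a b hab => ?_⟩
        by_cases hc : a = d ∧ b = e
        · rw [hc.1, hc.2, hEF, hz, zero_smul]
        · exact hFn a b hab hc
      have := congrFun (hv.weight_unique hM h0 hhv hne) d
      rw [Pi.sub_apply, hαd, eq_comm, sub_eq_self] at this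
      exact one_ne_zero this
    refine (M.isHighestWeight_iff _ _).2 ⟨v, h0, hv.1, fun a b hab => ?_⟩
    rcases oddReflection_symm_lt hadj hab with ⟨rfl, rfl⟩ | ⟨hlt, -⟩
    · exact hFv
    · exact hv.2 a b hlt
  · rw [if_neg hz]
    refine (M.isHighestWeight_iff _ _).2 ⟨F v, ?_, hFw, fun a b hab => ?_⟩
    · intro hFv
      rw [hFv, map_zero] at hEF
      exact smul_ne_zero hz h0 hEF.symm
    · rcases oddReflection_symm_lt hadj hab with ⟨rfl, rfl⟩ | ⟨hlt, hne⟩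
      · have h2 := M.act_single_act_single e d e d v
        have hs : koszulSign 1 1 = -1 := by simp [koszulSign, ZMod.val_one]
        rw [hpe, hs, if_neg hde, smul_zero, sub_zero, add_zero, neg_one_smul,
          ← add_eq_zero_iff_eq_neg, ← two_smul ℂ] at h2
        exact (smul_eq_zero.1 h2).resolve_left two_ne_zero
      · exact hFn a b hlt hne

end GLModule
end

/-! ### Combinatorics of the sequence of reflections -/

noncomputable section

/-- Turns membership in a prefix of a sorted list into an order condition, so that the roots already
used can be described without list positions. -/
theorem mem_take_of_pairwise {α : Type*} {R : α → α → Prop} (hR : ∀ x y, R x y → ¬R y x)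
    {l : List α} (hl : l.Pairwise R) {s : ℕ} (hs : s < l.length) (r : α) :
    r ∈ l.take s ↔ r ∈ l ∧ R r l[s] := by
  have hsplit : l = l.take s ++ l[s] :: l.drop (s + 1) := by simp
  have hl' := hl
  rw [hsplit, List.pairwise_append] at hl'
  refine ⟨fun h => ⟨List.mem_of_mem_take h, hl'.2.2 r h _ List.mem_cons_self⟩, fun ⟨h, hr⟩ => ?_⟩
  rw [hsplit, List.mem_append, List.mem_cons] at h
  rcases h with h | h | h
  · exact h
  · exact absurd hr (by rw [← h] at hr ⊢; exact hR _ _ hr)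
  · exact absurd hr (hR _ _ ((List.pairwise_cons.1 hl'.2.1).1 r h))

section Sequences

variable {m N : ℕ}

theorem mem_reflectionList (ξ : DESeq m N) (r : Fin N × Fin m) :
    r ∈ reflectionList ξ ↔ r.1.val < ell ξ r.2 := by
  obtain ⟨k, i⟩ := r
  simp only [reflectionList, List.mem_flatMap, List.mem_reverse, List.mem_finRange, true_and,
    List.mem_map, List.mem_filter, decide_eq_true_eq, Prod.mk.injEq]
  constructor
  · rintro ⟨i', k', h, rfl, rfl⟩
    exact h
  · exact fun h => ⟨i, k, h, rfl, rfl⟩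

theorem pairwise_reflectionList (ξ : DESeq m N) :
    (reflectionList ξ).Pairwise fun r r' => r'.2 < r.2 ∨ (r.2 = r'.2 ∧ r.1 < r'.1) := by
  rw [reflectionList, List.pairwise_flatMap]
  refine ⟨fun i _ => ?_, ?_⟩
  · rw [List.pairwise_map]
    exact ((List.pairwise_lt_finRange N).filter _).imp fun h => Or.inr ⟨rfl, h⟩
  · rw [List.pairwise_reverse]
    refine (List.pairwise_lt_finRange m).imp fun {i i'} h x hx y hy => Or.inl ?_
    obtain ⟨k, -, rfl⟩ := List.mem_map.1 hx
    obtain ⟨k', -, rfl⟩ := List.mem_map.1 hy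
    exact h

theorem mem_take_reflectionList (ξ : DESeq m N) {s : ℕ} (hs : s < (reflectionList ξ).length)
    (r : Fin N × Fin m) : r ∈ (reflectionList ξ).take s ↔ r.1.val < ell ξ r.2 ∧
      ((reflectionList ξ)[s].2 < r.2 ∨
        (r.2 = (reflectionList ξ)[s].2 ∧ r.1 < (reflectionList ξ)[s].1)) := by
  rw [mem_take_of_pairwise ?_ (pairwise_reflectionList ξ) hs, mem_reflectionList]
  rintro x y (h | ⟨h1, h2⟩) (h' | ⟨h1', h2'⟩)
  · exact lt_asymm h h'
  · exact h.ne h1'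
  · exact h'.ne h1
  · exact lt_asymm h2 h2'

theorem reflectionStage_succ (ξ : DESeq m N) {s : ℕ} (hs : s < (reflectionList ξ).length) :
    reflectionStage ξ (s + 1) = oddReflection (reflectionStage ξ s)
      (reflectionList ξ)[s].1 (reflectionList ξ)[s].2 := by
  rw [reflectionStage, ← List.take_concat_get' _ s hs, List.foldl_append]
  rfl

theorem IsDecreasing.ell_mono {ξ : DESeq m N} (hξ : IsDecreasing ξ) {i i' : Fin m} (h : i ≤ i') :
    ell ξ i ≤ ell ξ i' := by
  rcases h.eq_or_lt with rfl | h
  · exact le_rfl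
  · exact Finset.card_le_card (Finset.monotone_filter_right _ fun k _ hk => (hξ.1 i i' h).trans hk)

/-- The `δ`s to the right of `ε_i` have the smallest indices, and an initial segment of `Fin N` is
determined by its cardinality. -/
theorem IsDecreasing.lt_iff {ξ : DESeq m N} (hξ : IsDecreasing ξ) (i : Fin m) (k : Fin N) :
    ξ.symm (Sum.inl i) < ξ.symm (Sum.inr k) ↔ k.val < ell ξ i := by
  have hdown : ∀ k k' : Fin N, k' ≤ k → ξ.symm (Sum.inl i) < ξ.symm (Sum.inr k) →
      ξ.symm (Sum.inl i) < ξ.symm (Sum.inr k') := by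
    intro k k' h hk
    rcases h.eq_or_lt with rfl | h
    · exact hk
    · exact hk.trans (hξ.2 k' k h)
  constructor
  · intro h
    have := Finset.card_le_card (s := Finset.Iic k)
      (t := Finset.univ.filter fun k : Fin N => ξ.symm (Sum.inl i) < ξ.symm (Sum.inr k))
      fun k' hk' => by simpa using hdown k k' (Finset.mem_Iic.1 hk') h
    rw [Fin.card_Iic] at this
    exact this
  · intro h
    by_contra hk
    have := Finset.card_le_card (t := Finset.Iio k)
      (s := Finset.univ.filter fun k : Fin N => ξ.symm (Sum.inl i) < ξ.symm (Sum.inr k))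
      fun k' hk' => by
        rw [Finset.mem_Iio]
        by_contra hle
        exact hk (hdown k' k (not_lt.1 hle) (by simpa using hk'))
    rw [Fin.card_Iio] at this
    exact absurd h (not_lt.2 this)

/-- The positions of the symbols in the decreasing sequence in which `ε_i` stands to the left
of `δ_k` exactly for `(k, i) ∈ S`. -/
def HasPositions (η : DESeq m N) (S : Finset (Fin N × Fin m)) : Prop :=
  (∀ i : Fin m, (η.symm (Sum.inl i)).val + i + 1 + (Finset.univ.filter fun k => (k, i) ∈ S).card
    = m + N) ∧
  ∀ k : Fin N, (η.symm (Sum.inr k)).val + k + 1 = N + (Finset.univ.filter fun i => (k, i) ∈ S).card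

theorem HasPositions.unique {η η' : DESeq m N} {S : Finset (Fin N × Fin m)}
    (h : HasPositions η S) (h' : HasPositions η' S) : η = η' := by
  refine Equiv.symm_bijective.injective (Equiv.ext fun a => Fin.ext ?_)
  rcases a with i | k
  · have := h.1 i; have := h'.1 i; omega
  · have := h.2 k; have := h'.2 k; omega

theorem hasPositions_oppositeSeq : HasPositions (oppositeSeq m N) ∅ := by
  constructor
  · intro i
    simp [oppositeSeq, Fin.val_rev]
    omega
  · intro k
    simp [oppositeSeq, Fin.val_rev]
    omega

theorem card_filter_symm_lt (ξ : DESeq m N) (p : Fin (m + N)) :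
    (Finset.univ.filter fun i => ξ.symm (Sum.inl i) < p).card +
      (Finset.univ.filter fun k => ξ.symm (Sum.inr k) < p).card = p.val := by
  rw [Finset.card_filter, Finset.card_filter,
    ← Fintype.sum_sum_type (fun a => if ξ.symm a < p then 1 else 0), ← Finset.card_filter,
    ← Fin.card_Iio p]
  exact Finset.card_equiv ξ.symm (by simp)

/-- A position is the number of symbols to the left: those of the same kind with larger index, plus
those of the other kind, counted through the list. -/
theorem IsDecreasing.hasPositions {ξ : DESeq m N} (hξ : IsDecreasing ξ) :
    HasPositions ξ (reflectionList ξ).toFinset := by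
  have hmem : ∀ k i, (k, i) ∈ (reflectionList ξ).toFinset ↔ k.val < ell ξ i := by
    intro k i
    rw [List.mem_toFinset, mem_reflectionList]
  have hinl : ∀ i i', ξ.symm (Sum.inl i') < ξ.symm (Sum.inl i) ↔ i < i' := by
    intro i i'
    refine ⟨fun h => ?_, hξ.1 i i'⟩
    by_contra hle
    rcases (not_lt.1 hle).eq_or_lt with rfl | hlt
    · exact lt_irrefl _ h
    · exact lt_asymm h (hξ.1 i' i hlt)
  have hinr : ∀ i i', ξ.symm (Sum.inr i') < ξ.symm (Sum.inr i) ↔ i < i' := by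
    intro i i'
    refine ⟨fun h => ?_, hξ.2 i i'⟩
    by_contra hle
    rcases (not_lt.1 hle).eq_or_lt with rfl | hlt
    · exact lt_irrefl _ h
    · exact lt_asymm h (hξ.2 i' i hlt)
  constructor
  · intro i
    have h := card_filter_symm_lt ξ (ξ.symm (Sum.inl i))
    have h1 : (Finset.univ.filter fun i' => ξ.symm (Sum.inl i') < ξ.symm (Sum.inl i)).card
        = m - 1 - i := by
      rw [← Fin.card_Ioi]
      congr 1
      ext i'
      simp [hinl]
    have h2 := Finset.card_filter_add_card_filter_not (s := (Finset.univ : Finset (Fin N)))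
      (fun k => (k, i) ∈ (reflectionList ξ).toFinset)
    have h3 : (Finset.univ.filter fun k => ξ.symm (Sum.inr k) < ξ.symm (Sum.inl i)) =
        Finset.univ.filter fun k => ¬ (k, i) ∈ (reflectionList ξ).toFinset := by
      refine Finset.filter_congr fun k _ => ?_
      rw [hmem, ← hξ.lt_iff, not_lt, le_iff_lt_or_eq, or_iff_left]
      simp
    rw [h1, h3] at h
    rw [Finset.card_univ, Fintype.card_fin] at h2
    have := i.isLt
    omega
  · intro k
    have h := card_filter_symm_lt ξ (ξ.symm (Sum.inr k))
    have h1 : (Finset.univ.filter fun k' => ξ.symm (Sum.inr k') < ξ.symm (Sum.inr k)).card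
        = N - 1 - k := by
      rw [← Fin.card_Ioi]
      congr 1
      ext i'
      simp [hinr]
    have h3 : (Finset.univ.filter fun i => ξ.symm (Sum.inl i) < ξ.symm (Sum.inr k)) =
        Finset.univ.filter fun i => (k, i) ∈ (reflectionList ξ).toFinset := by
      refine Finset.filter_congr fun i _ => ?_
      rw [hmem, hξ.lt_iff]
    rw [h1, h3] at h
    have := k.isLt
    omega

theorem toFinset_take_succ (ξ : DESeq m N) {s : ℕ} (hs : s < (reflectionList ξ).length) :
    ((reflectionList ξ).take (s + 1)).toFinset =
      insert (reflectionList ξ)[s] ((reflectionList ξ).take s).toFinset := by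
  ext r
  rw [← List.take_concat_get' _ s hs, List.mem_toFinset, List.mem_append, List.mem_singleton,
    Finset.mem_insert, List.mem_toFinset, or_comm]

theorem getElem_notMem_take (ξ : DESeq m N) {s : ℕ} (hs : s < (reflectionList ξ).length) :
    (reflectionList ξ)[s] ∉ (reflectionList ξ).take s := by
  rw [mem_take_reflectionList ξ hs]
  simp

/-- The two claims feed each other: the position formulas show that the next two symbols are
adjacent, and swapping adjacent symbols moves each by one place, as the formulas for the enlarged
set of crossings require. -/
theorem IsDecreasing.hasPositions_reflectionStage {ξ : DESeq m N} (hξ : IsDecreasing ξ) {s : ℕ}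
    (hs : s ≤ (reflectionList ξ).length) :
    HasPositions (reflectionStage ξ s) ((reflectionList ξ).take s).toFinset ∧
      ∀ h : s < (reflectionList ξ).length,
        ((reflectionStage ξ s).symm (Sum.inr (reflectionList ξ)[s].1)).val + 1 =
          ((reflectionStage ξ s).symm (Sum.inl (reflectionList ξ)[s].2)).val := by
  have hadj : ∀ s (h : s < (reflectionList ξ).length),
      HasPositions (reflectionStage ξ s) ((reflectionList ξ).take s).toFinset →
        ((reflectionStage ξ s).symm (Sum.inr (reflectionList ξ)[s].1)).val + 1 =
          ((reflectionStage ξ s).symm (Sum.inl (reflectionList ξ)[s].2)).val := by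
    intro s h hp
    have hmem := mem_take_reflectionList ξ h
    have hL : (reflectionList ξ)[s].1.val < ell ξ (reflectionList ξ)[s].2 :=
      (mem_reflectionList ξ _).1 (List.getElem_mem h)
    generalize (reflectionList ξ)[s] = r at hmem hL ⊢
    obtain ⟨k, i⟩ := r
    have h1 := hp.1 i
    have h2 := hp.2 k
    have e1 : (Finset.univ.filter fun k' => (k', i) ∈ ((reflectionList ξ).take s).toFinset)
        = Finset.Iio k := by
      ext k'
      rw [Finset.mem_filter, List.mem_toFinset, hmem, Finset.mem_Iio]
      simp only [Finset.mem_univ, lt_self_iff_false, true_and, false_or, and_iff_right_iff_imp]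
      intro hk
      exact lt_trans hk hL
    -- `ell` is monotone in the index of `ε`, so `k < ell ξ i` forces `δ_k` to have passed every `ε`
    -- of larger index.
    have e2 : (Finset.univ.filter fun i' => (k, i') ∈ ((reflectionList ξ).take s).toFinset)
        = Finset.Ioi i := by
      ext i'
      rw [Finset.mem_filter, List.mem_toFinset, hmem, Finset.mem_Ioi]
      simp only [Finset.mem_univ, lt_self_iff_false, true_and, and_false, or_false,
        and_iff_right_iff_imp]
      intro hi
      exact lt_of_lt_of_le hL (hξ.ell_mono hi.le)
    rw [e1, Fin.card_Iio] at h1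
    rw [e2, Fin.card_Ioi] at h2
    have := i.isLt
    simp only
    omega
  suffices h : HasPositions (reflectionStage ξ s) ((reflectionList ξ).take s).toFinset from
    ⟨h, fun hs => hadj s hs h⟩
  induction s with
  | zero => simpa [reflectionStage] using hasPositions_oppositeSeq
  | succ s ih =>
    have hp := ih (Nat.le_of_succ_le hs)
    have ha := hadj s hs hp
    have hnot := getElem_notMem_take ξ hs
    rw [reflectionStage_succ ξ hs, toFinset_take_succ ξ hs]
    rw [← List.mem_toFinset] at hnot
    generalize (reflectionList ξ)[s] = r at ha hnot ⊢
    generalize ((reflectionList ξ).take s).toFinset = S at hp hnot ⊢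
    generalize reflectionStage ξ s = η at hp ha ⊢
    obtain ⟨k, i⟩ := r
    have hsw : ∀ c, (oddReflection η k i).symm c =
        η.symm (Equiv.swap (Sum.inr k) (Sum.inl i) c) := by
      intro c; simp [oddReflection]
    constructor
    · intro i'
      rw [hsw]
      by_cases hi : i' = i
      · subst hi
        have e : (Finset.univ.filter fun k' => (k', i') ∈ insert (k, i') S) =
            insert k (Finset.univ.filter fun k' => (k', i') ∈ S) := by
          ext k'; simp
        rw [e, Finset.card_insert_of_notMem (by simpa using hnot), Equiv.swap_apply_right]
        have := hp.1 i'
        simp only at ha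
        omega
      · rw [Equiv.swap_apply_of_ne_of_ne (by simp) (by simpa using hi)]
        simpa [hi] using hp.1 i'
    · intro k'
      rw [hsw]
      by_cases hi : k' = k
      · subst hi
        have e : (Finset.univ.filter fun i' => (k', i') ∈ insert (k', i) S) =
            insert i (Finset.univ.filter fun i' => (k', i') ∈ S) := by
          ext k'; simp
        rw [e, Finset.card_insert_of_notMem (by simpa using hnot), Equiv.swap_apply_left]
        have := hp.2 k'
        simp only at ha
        omega
      · rw [Equiv.swap_apply_of_ne_of_ne (by simpa using hi) (by simp), hp.2 k']
        simp [hi]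

theorem IsDecreasing.reflectionStage_length {ξ : DESeq m N} (hξ : IsDecreasing ξ) :
    reflectionStage ξ (reflectionList ξ).length = ξ := by
  have h := (hξ.hasPositions_reflectionStage le_rfl).1
  rw [List.take_length] at h
  exact h.unique hξ.hasPositions

end Sequences

/-! ### Weights along the sequence of reflections -/

theorem deltaSubEps_injective {m N : ℕ} :
    Function.Injective fun r : Fin N × Fin m => (deltaSubEps r.1 r.2 : GLWeight m N) := by
  rintro ⟨k, i⟩ ⟨k', i'⟩ h
  have h1 := congrFun h (Sum.inr k)
  have h2 := congrFun h (Sum.inl i)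
  simp only [deltaSubEps, Pi.sub_apply, Pi.single_apply] at h1 h2
  refine Prod.ext ?_ ?_
  · by_contra hne
    simp [show k ≠ k' from hne] at h1
  · by_contra hne
    simp [show i ≠ i' from hne] at h2

theorem sum_deltaSubEps_inr {m N : ℕ} (T : Finset (Fin N × Fin m)) (k : Fin N) :
    (∑ r ∈ T, (deltaSubEps r.1 r.2 : GLWeight m N)) (Sum.inr k) =
      (Finset.univ.filter fun i => (k, i) ∈ T).card := by
  have h : (Finset.univ.filter fun i => (k, i) ∈ T).card = (T.filter fun r => k = r.1).card := by
    refine Finset.card_bij (fun i _ => (k, i)) (by simp) (by simp) ?_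
    rintro ⟨k', i⟩ h
    obtain ⟨h, rfl⟩ := Finset.mem_filter.1 h
    exact ⟨i, by simpa using h, rfl⟩
  rw [h, Finset.card_filter]
  simp [deltaSubEps, Pi.single_apply]

theorem sum_deltaSubEps_inl {m N : ℕ} (T : Finset (Fin N × Fin m)) (i : Fin m) :
    (∑ r ∈ T, (deltaSubEps r.1 r.2 : GLWeight m N)) (Sum.inl i) =
      -(Finset.univ.filter fun k => (k, i) ∈ T).card := by
  have h : (Finset.univ.filter fun k => (k, i) ∈ T).card = (T.filter fun r => i = r.2).card := by
    refine Finset.card_bij (fun k _ => (k, i)) (by simp) (by simp) ?_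
    rintro ⟨k, i'⟩ h
    obtain ⟨h, rfl⟩ := Finset.mem_filter.1 h
    exact ⟨k, by simpa using h, rfl⟩
  rw [h, Finset.card_filter]
  simp [deltaSubEps, Pi.single_apply]

section Weights

variable {m n : ℕ}

/-- For natural numbers, $j+1\le 2a$ if and only if $\lfloor j/2\rfloor+1\le a$. -/
theorem transposePart_two_smul (lam : ℕ →₀ ℕ) (j : ℕ) :
    transposePart (2 • lam) (j + 1) = transposePart lam (j / 2 + 1) := by
  unfold transposePart
  congr 1
  ext i
  have h : (2 • lam) i = 2 * lam i := rfl
  rw [Finset.mem_filter, Finset.mem_filter, Finsupp.mem_support_iff, Finsupp.mem_support_iff, h]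
  omega

theorem neg_hookWeight_two_smul (lam : ℕ →₀ ℕ) :
    -hookWeight m (2 * n) (2 • lam) = lambdaZero m n lam := by
  ext a
  rcases a with i | k
  · simp [hookWeight, lambdaZero]
  · simp [hookWeight, lambdaZero, transposePart_two_smul]

theorem transposePart_le_of_lt {lam : ℕ →₀ ℕ} (hlam : Antitone lam) {i j : ℕ} (h : lam i < j) :
    transposePart lam j ≤ i := by
  rw [← Finset.card_range i]
  refine Finset.card_le_card fun i' hi' => ?_
  rw [Finset.mem_range]
  by_contra hle
  have h1 := (Finset.mem_filter.1 hi').2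
  have h2 := hlam (not_lt.1 hle)
  omega

/-- The roots among the first `s` of the reflection list that lie in the rows `k ≤ 2 λ_i`. -/
def changedPairs (lam : ℕ →₀ ℕ) (ξ : DESeq m (2 * n)) (s : ℕ) : Finset (Fin (2 * n) × Fin m) :=
  ((reflectionList ξ).take s).toFinset.filter fun r => r.1.val < 2 * lam r.2

/-- The highest weight after the first `s` reflections. -/
def stageWeight (lam : ℕ →₀ ℕ) (ξ : DESeq m (2 * n)) (s : ℕ) : GLWeight m (2 * n) :=
  lambdaZero m n lam - ∑ r ∈ changedPairs lam ξ s, deltaSubEps r.1 r.2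

theorem stageWeight_zero (lam : ℕ →₀ ℕ) (ξ : DESeq m (2 * n)) :
    stageWeight lam ξ 0 = lambdaZero m n lam := by
  simp [stageWeight, changedPairs]

theorem stageWeight_length (lam : ℕ →₀ ℕ) (ξ : DESeq m (2 * n)) :
    stageWeight lam ξ (reflectionList ξ).length = lambdaZero m n lam - rLam lam ξ := by
  classical
  rw [stageWeight, rLam, rootRows, Finset.sum_image deltaSubEps_injective.injOn]
  congr 2
  ext r
  simp [changedPairs, mem_reflectionList, ellLam]

theorem stageWeight_succ (lam : ℕ →₀ ℕ) (ξ : DESeq m (2 * n)) {s : ℕ}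
    (hs : s < (reflectionList ξ).length) :
    stageWeight lam ξ (s + 1) =
      if (reflectionList ξ)[s].1.val < 2 * lam (reflectionList ξ)[s].2 then
        stageWeight lam ξ s - deltaSubEps (reflectionList ξ)[s].1 (reflectionList ξ)[s].2
      else stageWeight lam ξ s := by
  have hnot := getElem_notMem_take ξ hs
  rw [stageWeight, changedPairs, toFinset_take_succ ξ hs, Finset.filter_insert]
  split_ifs with h
  · rw [Finset.sum_insert (by simp [hnot]), stageWeight, changedPairs]
    abel
  · rfl

/-- Both coordinates are nonpositive, so the sum vanishes only if both do. -/
theorem stageWeight_add_eq_zero_iff {lam : ℕ →₀ ℕ} (hlam : Antitone lam) (ξ : DESeq m (2 * n))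
    {s : ℕ} (hs : s < (reflectionList ξ).length) :
    stageWeight lam ξ s (Sum.inr (reflectionList ξ)[s].1) +
      stageWeight lam ξ s (Sum.inl (reflectionList ξ)[s].2) = 0 ↔
    ¬(reflectionList ξ)[s].1.val < 2 * lam (reflectionList ξ)[s].2 := by
  have hmem := mem_take_reflectionList ξ hs
  have hL : (reflectionList ξ)[s].1.val < ell ξ (reflectionList ξ)[s].2 :=
    (mem_reflectionList ξ _).1 (List.getElem_mem hs)
  generalize (reflectionList ξ)[s] = r at hmem hL ⊢
  obtain ⟨k, i⟩ := r
  simp only at hmem hL ⊢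
  rw [stageWeight, Pi.sub_apply, Pi.sub_apply, sum_deltaSubEps_inr, sum_deltaSubEps_inl]
  -- The earlier roots involving `ε_i` are those with `k' < k`; of these, the ones with `k' < 2 λ_i`
  -- were subtracted.
  have hcol : (Finset.univ.filter fun k' => (k', i) ∈ changedPairs lam ξ s) =
      Finset.univ.filter fun k' : Fin (2 * n) => k'.val < min k.val (2 * lam i) := by
    ext k'
    simp only [changedPairs, Finset.mem_filter, List.mem_toFinset, hmem, Finset.mem_univ,
      true_and, lt_self_iff_false, false_or, lt_min_iff, Fin.lt_def]
    omega
  have hcard : (Finset.univ.filter fun k' => (k', i) ∈ changedPairs lam ξ s).card =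
      min k.val (2 * lam i) := by
    rw [hcol, Fin.card_filter_val_lt]
    have := k.isLt
    omega
  rw [hcard]
  simp only [lambdaZero]
  constructor
  · intro h hlt
    -- With `d + 1 = 2 λ_i - k`, the negated sum is a natural number plus `d + 1`, hence nonzero.
    rw [min_eq_left hlt.le] at h
    obtain ⟨d, hd⟩ := Nat.exists_eq_add_of_lt hlt
    have hd' : (2 * lam i : ℂ) = k.val + d + 1 := by exact_mod_cast hd
    rw [hd'] at h
    have : ((transposePart lam (k.val / 2 + 1) - m +
      (Finset.univ.filter fun i' => (k, i') ∈ changedPairs lam ξ s).card + d + 1 : ℕ) : ℂ) = 0 := by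
      push_cast
      linear_combination -h
    exact Nat.succ_ne_zero _ (Nat.cast_eq_zero.1 this)
  · intro hle
    -- An earlier root `δ_k - ε_{i'}` has `i' > i`, so `2 λ_{i'} ≤ 2 λ_i ≤ k` and it was not
    -- subtracted.
    have hrow : (Finset.univ.filter fun i' => (k, i') ∈ changedPairs lam ξ s) = ∅ := by
      refine Finset.filter_eq_empty_iff.2 fun i' _ h => ?_
      obtain ⟨h1, h2⟩ := Finset.mem_filter.1 h
      rw [List.mem_toFinset, hmem] at h1
      simp only [lt_self_iff_false, and_false, or_false] at h1
      have := hlam (Fin.lt_def.1 h1.2).le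
      simp only at h2
      omega
    -- From `2 λ_i ≤ k` follows `λ_i < k / 2 + 1`, so this column has length at most `i < m`.
    have htr : transposePart lam (k.val / 2 + 1) - m = 0 := by
      have := transposePart_le_of_lt hlam (i := i) (j := k.val / 2 + 1) (by omega)
      have := i.isLt
      omega
    rw [hrow, htr, min_eq_right (not_lt.1 hle)]
    simp

theorem mem_rootRows (lam : ℕ →₀ ℕ) (ξ : DESeq m (2 * n)) (α : GLWeight m (2 * n)) :
    α ∈ rootRows lam ξ ↔ ∃ r ∈ reflectionList ξ, r.1.val < 2 * lam r.2 ∧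
      α = deltaSubEps r.1 r.2 := by
  simp only [rootRows, Finset.mem_image, Finset.mem_filter, Finset.mem_univ, true_and, ellLam,
    lt_min_iff, mem_reflectionList, and_assoc, eq_comm]

theorem isHighestWeight_reflectionStage {V : Type*} [AddCommGroup V] [Module ℂ V]
    {W : GLModule m (2 * n) V} (hW : W.IsIrreducible) {lam : ℕ →₀ ℕ} (hlam : Antitone lam)
    {ξ : DESeq m (2 * n)} (hξ : IsDecreasing ξ)
    (h0 : IsHighestWeight W (oppositeSeq m (2 * n)) (lambdaZero m n lam)) {s : ℕ}
    (hs : s ≤ (reflectionList ξ).length) :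
    IsHighestWeight W (reflectionStage ξ s) (stageWeight lam ξ s) := by
  induction s with
  | zero =>
    rw [stageWeight_zero]
    exact h0
  | succ s ih =>
    have h := GLModule.oddReflection_isHighestWeight hW
      ((hξ.hasPositions_reflectionStage (Nat.le_of_succ_le hs)).2 hs) (ih (Nat.le_of_succ_le hs))
    rw [reflectionStage_succ ξ hs, stageWeight_succ lam ξ hs]
    simp only [stageWeight_add_eq_zero_iff hlam ξ hs, ite_not] at h
    exact h

/-- By uniqueness, the weights witnessing a change must be the stage weights, so a root is changing
exactly when its step alters `stageWeight`. -/
theorem changingRoots_eq_rootRows {V : Type*} [AddCommGroup V] [Module ℂ V]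
    {W : GLModule m (2 * n) V} (hW : W.IsIrreducible) {lam : ℕ →₀ ℕ} (hlam : Antitone lam)
    {ξ : DESeq m (2 * n)} (hξ : IsDecreasing ξ)
    (h0 : IsHighestWeight W (oppositeSeq m (2 * n)) (lambdaZero m n lam)) :
    changingRoots W ξ = (rootRows lam ξ : Set (GLWeight m (2 * n))) := by
  have hstage := fun s (hs : s ≤ (reflectionList ξ).length) =>
    isHighestWeight_reflectionStage hW hlam hξ h0 hs
  ext α
  rw [Finset.mem_coe, mem_rootRows]
  constructor
  · rintro ⟨s, hs, rfl, μ, h1, h2⟩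
    refine ⟨_, List.getElem_mem hs, ?_, rfl⟩
    by_contra hle
    have e1 := GLModule.highestWeight_unique hW h1 (hstage s hs.le)
    have e2 := GLModule.highestWeight_unique hW h2 (hstage (s + 1) hs)
    rw [stageWeight_succ lam ξ hs, if_neg hle, e1, sub_eq_self] at e2
    -- The root is nonzero, since its `δ_k`-coordinate is 1.
    have := congrFun e2 (Sum.inr (reflectionList ξ)[s].1)
    simp [deltaSubEps] at this
  · rintro ⟨r, hr, hlt, rfl⟩
    obtain ⟨s, hs, rfl⟩ := List.getElem_of_mem hr
    refine ⟨s, hs, rfl, _, hstage s hs.le, ?_⟩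
    have := hstage (s + 1) hs
    rwa [stageWeight_succ lam ξ hs, if_pos hlt] at this

end Weights

theorem oppositeSeq_symm_lt {m N : ℕ} (a b : GLIdx m N)
    (h : (oppositeSeq m N).symm a < (oppositeSeq m N).symm b) :
    (standardSeq m N).symm b < (standardSeq m N).symm a := by
  simpa [oppositeSeq, standardSeq] using h
end

theorem mainTheorem5 (m n : ℕ) (lam : ℕ →₀ ℕ) (hlam : IsHookPartition m n lam)
    (ξ : DESeq m (2 * n)) (hξ : IsDecreasing ξ)
    {V : Type*} [AddCommGroup V] [Module ℂ V] [FiniteDimensional ℂ V]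
    (M : GLModule m (2 * n) V) (hM : IsHookModule M (2 • lam)) :
    (∀ μ, IsHighestWeight M.dual (oppositeSeq m (2 * n)) μ ↔ μ = lambdaZero m n lam) ∧
    changingRoots M.dual ξ = (rootRows lam ξ : Set (GLWeight m (2 * n))) ∧
    (∀ μ, IsHighestWeight M.dual ξ μ ↔ μ = lambdaZero m n lam - rLam lam ξ) := by
  have hW := GLModule.dual_isIrreducible hM.1
  have h0 : IsHighestWeight M.dual (oppositeSeq m (2 * n)) (lambdaZero m n lam) := by
    rw [← neg_hookWeight_two_smul]
    exact GLModule.dual_isHighestWeight_neg hM.1 oppositeSeq_symm_lt hM.2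
  have h1 : IsHighestWeight M.dual ξ (lambdaZero m n lam - rLam lam ξ) := by
    have h := isHighestWeight_reflectionStage hW hlam.1 hξ h0 le_rfl
    rwa [hξ.reflectionStage_length, stageWeight_length] at h
  refine ⟨fun μ => ⟨fun h => GLModule.highestWeight_unique hW h h0, ?_⟩,
    changingRoots_eq_rootRows hW hlam.1 hξ h0,
    fun μ => ⟨fun h => GLModule.highestWeight_unique hW h h1, ?_⟩⟩
  · rintro rfl; exact h0
  · rintro rfl; exact h1
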